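/- Let $d$ be a natural number and let $\mathcal K_{bcs}(\mathbb R^d)$ denote the collection of all nonempty, closed, bounded, convex subsets $K\subset\mathbb R^d$ that are symmetric ($-K=K$). Let $(\Omega,\mathcal A)$ be a measurable space, and let $F:\Omega\to\mathcal K_{bcs}(\mathbb R^d)$ be measurable in the sense that $\{x\in\Omega: F(x)\cap U\neq\emptyset\}\in\mathcal A$ for every open set $U\subset\mathbb R^d$. Let $\overline{\mathbf B}$ be the closed Euclidean unit ball of $\mathbb R^d$. Then there exists a measurable map $W$ from $\Omega$ to the $d\times d$ real matrices such that (i) for every $x\in\Omega$, the columns of $W(x)$ are mutually orthogonal (some of them may be zero); (ii) for every $x\in\Omega$, $$W(x)\overline{\mathbf B}\subset F(x)\subset\sqrt d\,W(x)\overline{\mathbf B}.$$ -/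

import Mathlib

open scoped Pointwise

/-- The class of nonempty, closed, bounded, convex, symmetric subsets of `ℝ^d`. -/
def Kbcs (d : ℕ) : Set (Set (EuclideanSpace ℝ (Fin d))) :=
  {K | K.Nonempty ∧ IsClosed K ∧ Bornology.IsBounded K ∧ Convex ℝ K ∧ -K = K}

/-- A set-valued map `F` is measurable if `{x | F x ∩ U ≠ ∅}` is measurable for every
open set `U`. -/
def SetValuedMeasurable {Ω : Type*} [MeasurableSpace Ω] {d : ℕ}
    (F : Ω → Set (EuclideanSpace ℝ (Fin d))) : Prop :=
  ∀ U : Set (EuclideanSpace ℝ (Fin d)), IsOpen U → MeasurableSet {x : Ω | (F x ∩ U).Nonempty}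

/-- The (possibly degenerate) ellipsoid `A B̄`: the image of the closed Euclidean unit ball
of `ℝ^d` under the matrix `A`. -/
def ellipsoid {d : ℕ} (A : Matrix (Fin d) (Fin d) ℝ) : Set (EuclideanSpace ℝ (Fin d)) :=
  Matrix.toEuclideanLin A '' Metric.closedBall 0 1

/-! If `K` contains a ball about 0, maximize the determinant over the closed convex hull of the
matrices `y yᵀ`, `y ∈ K`. A maximizer `Q = A Aᵀ` satisfies `uᵀ Q u ≤ sup_K (u · y)²`, so separation
and Cauchy–Schwarz put `A B̄` inside `K`. Moving `Q` towards `y yᵀ` cannot raise the determinant,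
which forces `|A⁻¹ y|² ≤ d`. The spectral theorem makes the columns of `A` orthogonal
(`exists_john_ellipsoid_of_ball_subset`).

A degenerate `K` is a limit of its thickenings, and the maps found for these subconverge
(`sandwichingMaps_nonempty`). The admissible maps for each `x` thus form a nonempty compact set.
Whether it meets a closed set is decided by countably many approximate tests
(`measurableSet_sandwichingMaps_inter`). Minimizing the matrix entries one after another then fixes
every entry measurably (`exists_selection_measurable_comp`). -/

/-! ### John's ellipsoid by determinant maximization -/

open Matrix in
/-- A positive semidefinite real matrix factors as `A * Aᵀ` with `A` having orthogonal columns. -/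
theorem exists_mul_transpose_eq_of_posSemidef {d : ℕ} {Q : Matrix (Fin d) (Fin d) ℝ}
    (hQ : Q.PosSemidef) :
    ∃ A : Matrix (Fin d) (Fin d) ℝ,
      (∀ i j : Fin d, i ≠ j → A.col i ⬝ᵥ A.col j = 0) ∧ A * Aᵀ = Q := by
  set U : Matrix (Fin d) (Fin d) ℝ := (hQ.1.eigenvectorUnitary).1 with hU
  set D : Matrix (Fin d) (Fin d) ℝ := diagonal fun i => √(hQ.1.eigenvalues i) with hD
  have hUU : Uᵀ * U = 1 := Unitary.coe_star_mul_self hQ.1.eigenvectorUnitary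
  have hDD : D * D = diagonal hQ.1.eigenvalues := by
    rw [hD, diagonal_mul_diagonal]
    congr 1
    ext i
    exact Real.mul_self_sqrt (hQ.eigenvalues_nonneg i)
  have hDt : Dᵀ = D := diagonal_transpose _
  refine ⟨U * D, fun i j hij => ?_, ?_⟩
  · have h : (U * D)ᵀ * (U * D) = diagonal hQ.1.eigenvalues := by
      rw [transpose_mul, hDt, Matrix.mul_assoc, ← Matrix.mul_assoc Uᵀ, hUU, Matrix.one_mul, hDD]
    have h' := congrFun (congrFun h i) j
    rw [diagonal_apply_ne _ hij] at h'
    exact h'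
  · rw [transpose_mul, hDt, Matrix.mul_assoc, ← Matrix.mul_assoc D, hDD]
    have h := hQ.1.spectral_theorem
    rw [Unitary.conjStarAlgAut_apply, Matrix.mul_assoc] at h
    exact h.symm

/-- If `(1 + s * t) ≤ (1 + s) ^ d` for all `s > 0` then `t ≤ d`. -/
theorem le_natCast_of_one_add_mul_le_pow {d : ℕ} {t : ℝ}
    (h : ∀ s : ℝ, 0 < s → 1 + s * t ≤ (1 + s) ^ d) : t ≤ d := by
  -- Both sides equal 1 at `s = 0`, so their right derivatives there compare.
  have hd : HasDerivAt (fun s : ℝ => (1 + s) ^ d) (d : ℝ) 0 := by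
    simpa [Pi.pow_def] using ((hasDerivAt_id (0 : ℝ)).const_add 1).pow d
  have ht := hd.tendsto_slope.mono_left (nhdsGT_le_nhdsNE (0 : ℝ))
  refine ge_of_tendsto ht ?_
  filter_upwards [self_mem_nhdsWithin] with s hs
  have hs : 0 < s := hs
  rw [slope_def_field, le_div_iff₀ (by linarith)]
  have := h s hs
  simp
  linarith

theorem isCompact_closure_convexHull {V : Type*} [NormedAddCommGroup V] [NormedSpace ℝ V]
    [ProperSpace V] {s : Set V} (hs : IsCompact s) : IsCompact (closure (convexHull ℝ s)) :=
  Metric.isCompact_of_isClosed_isBounded isClosed_closure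
    (isBounded_convexHull.2 hs.isBounded).closure

attribute [local instance] Matrix.normedAddCommGroup Matrix.normedSpace in
open Matrix in
/-- The closed convex hull of the rank one matrices `y yᵀ`, `y ∈ K`. -/
theorem isCompact_closure_convexHull_vecMulVec {d : ℕ} {K : Set (EuclideanSpace ℝ (Fin d))}
    (hK : IsCompact K) :
    IsCompact (closure (convexHull ℝ ((fun y => vecMulVec y.ofLp y.ofLp) '' K))) := by
  refine isCompact_closure_convexHull (hK.image ?_)
  fun_prop

-- Each condition is closed and convex in `Q`, so it need only be checked on the generators, where
-- `uᵀ k kᵀ u = (u · k)²`.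
open Matrix in
theorem quadratic_bounds_of_mem_closure_convexHull {d : ℕ} {K : Set (EuclideanSpace ℝ (Fin d))}
    {Q : Matrix (Fin d) (Fin d) ℝ}
    (hQ : Q ∈ closure (convexHull ℝ ((fun y => vecMulVec y.ofLp y.ofLp) '' K))) :
    Q.PosSemidef ∧ ∀ (u : Fin d → ℝ) (c : ℝ), (∀ k ∈ K, (u ⬝ᵥ k.ofLp) ^ 2 ≤ c) →
      u ⬝ᵥ Q *ᵥ u ≤ c := by
  have hvv : ∀ u k : Fin d → ℝ, u ⬝ᵥ vecMulVec k k *ᵥ u = (u ⬝ᵥ k) ^ 2 := fun u k => by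
    rw [vecMulVec_mulVec, sq]
    simp [dotProduct_comm]
  have hcont : ∀ u : Fin d → ℝ, Continuous fun M : Matrix (Fin d) (Fin d) ℝ => u ⬝ᵥ M *ᵥ u :=
    fun u => by fun_prop
  have hlin : ∀ u : Fin d → ℝ, IsLinearMap ℝ fun M : Matrix (Fin d) (Fin d) ℝ => u ⬝ᵥ M *ᵥ u :=
    fun u => ⟨fun M N => by simp [add_mulVec], fun c M => by simp [smul_mulVec]⟩
  have hsym : Qᵀ = Q := by
    have hc : Convex ℝ {M : Matrix (Fin d) (Fin d) ℝ | Mᵀ = M} := by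
      intro M hM N hN a b _ _ _
      simp only [Set.mem_ofPred_eq] at hM hN ⊢
      simp [hM, hN]
    refine closure_minimal (convexHull_min ?_ hc) (isClosed_eq (by fun_prop) (by fun_prop)) hQ
    rintro _ ⟨k, -, rfl⟩
    simp
  refine ⟨.of_dotProduct_mulVec_nonneg hsym fun u => ?_, fun u c huc => ?_⟩
  · refine closure_minimal (convexHull_min ?_ (convex_halfSpace_ge (hlin u) 0))
      (isClosed_le continuous_const (hcont u)) hQ
    rintro _ ⟨k, -, rfl⟩
    simpa only [Set.mem_ofPred_eq, hvv] using sq_nonneg _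
  · refine closure_minimal (convexHull_min ?_ (convex_halfSpace_le (hlin u) c))
      (isClosed_le (hcont u) continuous_const) hQ
    rintro _ ⟨k, hk, rfl⟩
    simpa only [Set.mem_ofPred_eq, hvv] using huc k hk

open Matrix in
theorem exists_mem_convexHull_det_pos {d : ℕ} {K : Set (EuclideanSpace ℝ (Fin d))} {r : ℝ}
    (hr : 0 < r) (hrK : Metric.closedBall 0 r ⊆ K) :
    ∃ Q ∈ convexHull ℝ ((fun y => vecMulVec y.ofLp y.ofLp) '' K), 0 < Q.det := by
  rcases Nat.eq_zero_or_pos d with rfl | hd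
  · exact ⟨_, subset_convexHull ℝ _ ⟨0, hrK (by simp [hr.le]), rfl⟩, by simp⟩
  have hd' : (0 : ℝ) < d := by exact_mod_cast hd
  -- The average of the rank one matrices of the vectors `r eᵢ`.
  refine ⟨(r ^ 2 / d) • 1, ?_, by simp; positivity⟩
  have h := (convex_convexHull ℝ ((fun y : EuclideanSpace ℝ (Fin d) =>
    vecMulVec y.ofLp y.ofLp) '' K)).sum_mem (t := Finset.univ) (w := fun _ : Fin d => (1 / d : ℝ))
    (z := fun i => vecMulVec (Pi.single i r) (Pi.single i r)) (fun _ _ => by positivity)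
    (by simp; field_simp) (fun i _ => subset_convexHull ℝ _
      ⟨EuclideanSpace.single i r, hrK (by simp [abs_of_pos hr]), rfl⟩)
  convert h using 1
  ext i j
  simp only [Matrix.sum_apply, Matrix.smul_apply, vecMulVec_apply, one_apply, Pi.single_apply]
  by_cases hij : i = j
  · subst hij
    simp
    ring
  · simp [hij]

open Matrix in
/-- **John's theorem** for symmetric convex bodies. -/
theorem exists_john_ellipsoid_of_ball_subset {d : ℕ} {K : Set (EuclideanSpace ℝ (Fin d))}
    (hK : IsCompact K) (hconv : Convex ℝ K) (hsymm : -K = K) {r : ℝ} (hr : 0 < r)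
    (hrK : Metric.closedBall 0 r ⊆ K) :
    ∃ A : Matrix (Fin d) (Fin d) ℝ, (∀ i j : Fin d, i ≠ j → A.col i ⬝ᵥ A.col j = 0) ∧
      ellipsoid A ⊆ K ∧ K ⊆ √d • ellipsoid A := by
  set C := closure (convexHull ℝ ((fun y : EuclideanSpace ℝ (Fin d) =>
    vecMulVec y.ofLp y.ofLp) '' K)) with hC
  obtain ⟨Q₀, hQ₀, hQ₀det⟩ := exists_mem_convexHull_det_pos hr hrK
  obtain ⟨Q, hQC, hQmax⟩ := (isCompact_closure_convexHull_vecMulVec hK).exists_isMaxOn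
    ⟨Q₀, subset_closure hQ₀⟩ (Continuous.continuousOn (continuous_id.matrix_det))
  have hQdet : 0 < Q.det := hQ₀det.trans_le (hQmax (subset_closure hQ₀))
  obtain ⟨hQpos, hQle⟩ := quadratic_bounds_of_mem_closure_convexHull hQC
  obtain ⟨A, hAorth, hAQ⟩ := exists_mul_transpose_eq_of_posSemidef hQpos
  have hAdet : IsUnit A.det := by
    rw [isUnit_iff_ne_zero]
    rintro h
    rw [← hAQ, det_mul, h, zero_mul] at hQdet
    exact hQdet.false
  refine ⟨A, hAorth, ?_, ?_⟩
  · rintro _ ⟨w, hw, rfl⟩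
    by_contra hAw
    obtain ⟨f, c, hfK, hcf⟩ := geometric_hahn_banach_closed_point hconv hK.isClosed hAw
    set u := (InnerProductSpace.toDual ℝ _).symm f with hu
    have hfu : ∀ v, f v = u.ofLp ⬝ᵥ v.ofLp := fun v => by
      rw [← InnerProductSpace.toDual_symm_apply, ← hu, EuclideanSpace.inner_eq_star_dotProduct]
      simp [dotProduct_comm]
    have h0 : 0 < c := by simpa using hfK 0 (hrK (by simp [hr.le]))
    have hb : u.ofLp ⬝ᵥ Q *ᵥ u.ofLp ≤ c ^ 2 := by
      refine hQle _ _ fun k hk => ?_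
      have h1 := hfK k hk
      have h2 := hfK (-k) (by rw [← hsymm]; simpa using hk)
      rw [map_neg] at h2
      rw [← hfu]
      exact sq_le_sq' (by linarith) h1.le
    have hw' : w.ofLp ⬝ᵥ w.ofLp ≤ 1 := by
      have : ‖w‖ ≤ 1 := by simpa using hw
      have h := EuclideanSpace.real_norm_sq_eq w
      simp only [dotProduct, ← sq]
      rw [← h]
      exact pow_le_one₀ (norm_nonneg _) this
    have hcs : (u.ofLp ⬝ᵥ A *ᵥ w.ofLp) ^ 2 ≤ u.ofLp ⬝ᵥ Q *ᵥ u.ofLp * (w.ofLp ⬝ᵥ w.ofLp) := by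
      rw [← hAQ, ← mulVec_mulVec, dotProduct_mulVec, dotProduct_mulVec, mulVec_transpose]
      simpa only [dotProduct, sq] using
        Finset.sum_mul_sq_le_sq_mul_sq Finset.univ (u.ofLp ᵥ* A) w.ofLp
    rw [hfu, ofLp_toLpLin] at hcf
    simp only [Matrix.toLin'_apply] at hcf
    have hnn : 0 ≤ u.ofLp ⬝ᵥ Q *ᵥ u.ofLp := by
      simpa using hQpos.dotProduct_mulVec_nonneg u.ofLp
    nlinarith
  · intro y hy
    set z := A⁻¹ *ᵥ y.ofLp with hz
    have hAz : A *ᵥ z = y.ofLp := by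
      rw [hz, mulVec_mulVec, mul_nonsing_inv _ hAdet, one_mulVec]
    have hzd : z ⬝ᵥ z ≤ d := by
      refine le_natCast_of_one_add_mul_le_pow fun s hs => ?_
      -- Maximality of `det Q` against this convex combination of `Q` and `y yᵀ` will read `1 + s
      -- |z|² ≤ (1 + s) ^ d`.
      have hmem : (1 / (1 + s)) • (Q + s • vecMulVec y.ofLp y.ofLp) ∈ C := by
        have := (convex_convexHull ℝ _).closure hQC (subset_closure (subset_convexHull ℝ _
          ⟨y, hy, rfl⟩)) (a := 1 / (1 + s)) (b := s / (1 + s)) (by positivity) (by positivity)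
          (by field_simp)
        rw [smul_add, smul_smul]
        convert this using 3
        ring
      have hfac : Q + s • vecMulVec y.ofLp y.ofLp = A * (1 + s • vecMulVec z z) * Aᵀ := by
        rw [← hAz, ← hAQ, Matrix.mul_add, Matrix.add_mul, Matrix.mul_one, Matrix.mul_smul, Matrix.smul_mul,
          mul_vecMulVec, vecMulVec_mul, vecMul_transpose]
      have hdet1 : (1 + s • vecMulVec z z).det = 1 + s * (z ⬝ᵥ z) := by
        rw [← smul_vecMulVec, vecMulVec_eq Unit, det_one_add_replicateCol_mul_replicateRow,
          dotProduct_smul, smul_eq_mul]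
      have hle : ((1 / (1 + s)) • (Q + s • vecMulVec y.ofLp y.ofLp)).det ≤ Q.det := hQmax hmem
      rw [det_smul, hfac, det_mul, det_mul, hdet1, Fintype.card_fin, one_div, inv_pow,
        mul_right_comm A.det, ← det_mul, hAQ, inv_mul_le_iff₀ (by positivity),
        mul_comm _ Q.det, mul_le_mul_iff_right₀ hQdet] at hle
      exact hle
    -- The witness below divides by `√d`.
    rcases Nat.eq_zero_or_pos d with rfl | hd
    · exact ⟨0, ⟨0, by simp, by simp⟩, Subsingleton.elim _ _⟩
    have hd' : (0 : ℝ) < √d := by simpa using hd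
    refine ⟨_, ⟨WithLp.toLp 2 ((√d)⁻¹ • z), ?_, rfl⟩, ?_⟩
    · rw [mem_closedBall_zero_iff, ← sq_le_one_iff₀ (norm_nonneg _), EuclideanSpace.real_norm_sq_eq]
      simp only [Pi.smul_apply, smul_eq_mul, mul_pow, ← Finset.mul_sum, inv_pow,
        Real.sq_sqrt (Nat.cast_nonneg d)]
      rw [inv_mul_le_iff₀ (by exact_mod_cast hd), mul_one]
      simpa [dotProduct, sq] using hzd
    · ext i
      simp only [toLpLin_apply, mulVec_smul, hAz]
      simp [hd'.ne']

/-! ### Approximate sandwiching, compactness and measurability -/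

-- Turns closeness to `K` into countably many hits of open balls, the kind of event that the
-- measurability of `F` controls.
open Metric Filter Topology in
theorem mem_cthickening_iff_forall_inter_ball {X : Type*} [PseudoMetricSpace X] {K : Set X}
    {p : X} {ε : ℝ} (hε : 0 ≤ ε) :
    p ∈ cthickening ε K ↔ ∀ m : ℕ, (K ∩ ball p (ε + 1 / (m + 1))).Nonempty := by
  have key : ∀ δ, p ∈ thickening δ K ↔ (K ∩ ball p δ).Nonempty := fun δ => by
    simp only [mem_thickening_iff, Set.Nonempty, Set.mem_inter_iff, mem_ball, dist_comm]
  constructor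
  · intro h m
    rw [← key]
    exact cthickening_subset_thickening' (by positivity)
      (lt_add_of_pos_right _ (by positivity)) K h
  · intro h
    rw [cthickening_eq_iInter_thickening hε]
    simp only [Set.mem_iInter]
    intro δ hδ
    obtain ⟨m, hm⟩ := exists_nat_one_div_lt (sub_pos.2 hδ)
    exact thickening_mono (by linarith) K ((key _).2 (h m))

/-- `K` is squeezed, up to `ε`, between the images of the unit ball under `T` and `c • T`. -/
def IsSandwiched {V : Type*} [NormedAddCommGroup V] [NormedSpace ℝ V] (c : ℝ) (K : Set V)
    (ε : ℝ) (T : V →L[ℝ] V) : Prop :=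
  T '' Metric.closedBall 0 1 ⊆ Metric.cthickening ε K ∧
    K ⊆ Metric.cthickening ε (c • T '' Metric.closedBall 0 1)

section Sandwich

open Metric Filter Topology

variable {V : Type*} [NormedAddCommGroup V] [NormedSpace ℝ V] {c ε η : ℝ} {K : Set V}
  {T T' : V →L[ℝ] V}

theorem IsSandwiched.mono (h : IsSandwiched c K ε T) (hεη : ε ≤ η) : IsSandwiched c K η T :=
  ⟨h.1.trans (cthickening_mono hεη _), h.2.trans (cthickening_mono hεη _)⟩

theorem IsSandwiched.of_subset (h₁ : T '' closedBall 0 1 ⊆ K) (h₂ : K ⊆ c • T '' closedBall 0 1) :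
    IsSandwiched c K ε T :=
  ⟨h₁.trans (self_subset_cthickening _), h₂.trans (self_subset_cthickening _)⟩

/-- The inner inclusion loses `η` and the outer one `c * η`; `(1 + c) * η` covers both. -/
theorem IsSandwiched.perturb (hc : 0 ≤ c) (hε : 0 ≤ ε) (h : IsSandwiched c K ε T)
    (hT : dist T T' ≤ η) : IsSandwiched c K (ε + (1 + c) * η) T' := by
  have hη : 0 ≤ η := dist_nonneg.trans hT
  have hd : ∀ w ∈ closedBall (0 : V) 1, dist (T w) (T' w) ≤ η := fun w hw => by
    rw [dist_eq_norm, ← sub_apply]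
    refine ((T - T').le_opNorm w).trans ?_
    rw [← dist_eq_norm]
    exact (mul_le_of_le_one_right dist_nonneg (by simpa using hw)).trans hT
  constructor
  · rintro _ ⟨w, hw, rfl⟩
    have h1 : T' w ∈ cthickening η (cthickening ε K) :=
      mem_cthickening_of_dist_le _ (T w) _ _ (h.1 ⟨w, hw, rfl⟩) (by rw [dist_comm]; exact hd w hw)
    refine cthickening_mono ?_ _ (cthickening_cthickening_subset hη hε _ h1)
    nlinarith
  · have h1 : c • T '' closedBall 0 1 ⊆ cthickening (c * η) (c • T' '' closedBall 0 1) := by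
      rintro _ ⟨_, ⟨w, hw, rfl⟩, rfl⟩
      refine mem_cthickening_of_dist_le _ (c • T' w) _ _ ⟨_, ⟨w, hw, rfl⟩, rfl⟩ ?_
      simp only [dist_smul₀, Real.norm_of_nonneg hc]
      exact mul_le_mul_of_nonneg_left (hd w hw) hc
    refine (h.2.trans (cthickening_subset_of_subset ε h1)).trans
      ((cthickening_cthickening_subset hε (by positivity) _).trans (cthickening_mono ?_ _))
    nlinarith

theorem subset_of_forall_isSandwiched [ProperSpace V] (hK : IsClosed K)
    (h : ∀ ε > 0, IsSandwiched c K ε T) :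
    T '' closedBall 0 1 ⊆ K ∧ K ⊆ c • T '' closedBall 0 1 := by
  have hE : IsClosed (c • T '' closedBall (0 : V) 1) :=
    (((isCompact_closedBall _ _).image T.continuous).smul c).isClosed
  constructor
  · rw [← hK.closure_eq, closure_eq_iInter_cthickening]
    exact Set.subset_iInter₂ fun ε hε => (h ε hε).1
  · rw [← hE.closure_eq, closure_eq_iInter_cthickening]
    exact Set.subset_iInter₂ fun ε hε => (h ε hε).2

/-- Limits of approximately sandwiching maps are sandwiching. -/
theorem subset_of_tendsto_isSandwiched [ProperSpace V] (hc : 0 ≤ c) (hK : IsClosed K)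
    {δ : ℕ → ℝ} {S : ℕ → V →L[ℝ] V} (hδ : ∀ n, 0 ≤ δ n) (hδ0 : Tendsto δ atTop (𝓝 0))
    (hS : ∀ n, IsSandwiched c K (δ n) (S n)) (hT : Tendsto S atTop (𝓝 T)) :
    T '' closedBall 0 1 ⊆ K ∧ K ⊆ c • T '' closedBall 0 1 := by
  refine subset_of_forall_isSandwiched hK fun ε hε => ?_
  have h : Tendsto (fun n => δ n + (1 + c) * dist (S n) T) atTop (𝓝 0) := by
    simpa using hδ0.add ((tendsto_iff_dist_tendsto_zero.1 hT).const_mul (1 + c))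
  obtain ⟨n, hn⟩ := (h.eventually (gt_mem_nhds hε)).exists
  exact ((hS n).perturb hc (hδ n) le_rfl).mono hn.le

theorem IsSandwiched.norm_le {R : ℝ} (hR : 0 ≤ R) (hε : 0 ≤ ε) (hKR : K ⊆ closedBall 0 R)
    (h : IsSandwiched c K ε T) : ‖T‖ ≤ R + ε := by
  refine ContinuousLinearMap.opNorm_le_of_unit_norm (by positivity) fun w hw => ?_
  have h1 := cthickening_subset_of_subset ε hKR (h.1 ⟨w, by simp [hw], rfl⟩)
  rw [cthickening_closedBall hε hR] at h1
  simpa [add_comm] using h1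

theorem exists_tendsto_of_isSandwiched [FiniteDimensional ℝ V] (hc : 0 ≤ c)
    (hK : IsClosed K) (hKb : Bornology.IsBounded K)
    {δ : ℕ → ℝ} {S : ℕ → V →L[ℝ] V} (hδ : ∀ n, 0 ≤ δ n) (hδ0 : Tendsto δ atTop (𝓝 0))
    (hS : ∀ n, IsSandwiched c K (δ n) (S n)) :
    ∃ T, ∃ φ : ℕ → ℕ, Tendsto (S ∘ φ) atTop (𝓝 T) ∧
      T '' closedBall 0 1 ⊆ K ∧ K ⊆ c • T '' closedBall 0 1 := by
  have : ProperSpace V := FiniteDimensional.proper_real V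
  have : ProperSpace (V →L[ℝ] V) := FiniteDimensional.proper_real _
  obtain ⟨R, hR0, hR⟩ := hKb.subset_closedBall_lt 0 0
  obtain ⟨M, hM⟩ := hδ0.bddAbove_range
  have hb : ∀ n, S n ∈ closedBall (0 : V →L[ℝ] V) (R + M) := fun n => by
    rw [mem_closedBall_zero_iff]
    exact ((hS n).norm_le hR0.le (hδ n) hR).trans (by linarith [hM ⟨n, rfl⟩])
  obtain ⟨T, -, φ, hφ, hT⟩ := (isCompact_closedBall _ _).tendsto_subseq hb
  exact ⟨T, φ, hT, subset_of_tendsto_isSandwiched hc hK (fun n => hδ (φ n))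
    (hδ0.comp hφ.tendsto_atTop) (fun n => hS (φ n)) hT⟩

/-- The maps in `O` whose image of the unit ball lies in `K` and covers `K` after scaling
by `c`. -/
def sandwichingMaps (O : Set (V →L[ℝ] V)) (c : ℝ) (K : Set V) : Set (V →L[ℝ] V) :=
  {T | T ∈ O ∧ T '' closedBall 0 1 ⊆ K ∧ K ⊆ c • T '' closedBall 0 1}

theorem isCompact_sandwichingMaps [FiniteDimensional ℝ V] {O : Set (V →L[ℝ] V)} (hO : IsClosed O)
    (hc : 0 ≤ c) (hK : IsClosed K) (hKb : Bornology.IsBounded K) :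
    IsCompact (sandwichingMaps O c K) := by
  have : ProperSpace V := FiniteDimensional.proper_real V
  have : ProperSpace (V →L[ℝ] V) := FiniteDimensional.proper_real _
  obtain ⟨R, hR0, hR⟩ := hKb.subset_closedBall_lt 0 0
  refine isCompact_of_isClosed_isBounded (IsSeqClosed.isClosed fun S T hS hT => ?_)
    (isBounded_closedBall (x := 0) (r := R + 0) |>.subset fun T hT => ?_)
  · exact ⟨hO.isSeqClosed (fun n => (hS n).1) hT,
      subset_of_tendsto_isSandwiched hc hK (fun _ => le_rfl) tendsto_const_nhds
        (fun n => .of_subset (hS n).2.1 (hS n).2.2) hT⟩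
  · rw [mem_closedBall_zero_iff]
    exact (IsSandwiched.of_subset hT.2.1 hT.2.2).norm_le hR0.le le_rfl hR

/-- The first inclusion is closed in `w`, hence testable on a countable dense subset of the ball;
the second says that `F x` misses an open set. -/
theorem measurableSet_isSandwiched [FiniteDimensional ℝ V] {Ω : Type*} [MeasurableSpace Ω]
    {F : Ω → Set V} (hF : ∀ U, IsOpen U → MeasurableSet {x | (F x ∩ U).Nonempty})
    (hε : 0 ≤ ε) : MeasurableSet {x | IsSandwiched c (F x) ε T} := by
  have : ProperSpace V := FiniteDimensional.proper_real V
  obtain ⟨D, hDB, hDc, hBD⟩ :=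
    (TopologicalSpace.IsSeparable.of_separableSpace
      (closedBall (0 : V) 1)).exists_countable_dense_subset
  have h1 : {x | T '' closedBall 0 1 ⊆ cthickening ε (F x)} =
      ⋂ w ∈ D, ⋂ m : ℕ, {x | (F x ∩ ball (T w) (ε + 1 / (m + 1))).Nonempty} := by
    ext x
    simp only [Set.mem_ofPred_eq, Set.mem_iInter, ← mem_cthickening_iff_forall_inter_ball hε]
    refine ⟨fun h w hw => h ⟨w, hDB hw, rfl⟩, fun h => ?_⟩
    rw [Set.image_subset_iff]
    exact hBD.trans (closure_minimal h (isClosed_cthickening.preimage T.continuous))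
  have h2 : {x | F x ⊆ cthickening ε (c • T '' closedBall 0 1)} =
      {x | (F x ∩ (cthickening ε (c • T '' closedBall 0 1))ᶜ).Nonempty}ᶜ := by
    ext x
    simp only [Set.mem_ofPred_eq, Set.mem_compl_iff, Set.inter_compl_nonempty_iff, not_not]
  refine MeasurableSet.inter (s₁ := {x | T '' closedBall 0 1 ⊆ cthickening ε (F x)})
    (s₂ := {x | F x ⊆ cthickening ε (c • T '' closedBall 0 1)}) ?_ ?_
  · rw [h1]
    exact .biInter hDc fun w _ => .iInter fun m => hF _ isOpen_ball
  · rw [h2]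
    exact (hF _ isClosed_cthickening.isOpen_compl).compl

theorem measurableSet_sandwichingMaps_inter [FiniteDimensional ℝ V] {Ω : Type*}
    [MeasurableSpace Ω] {F : Ω → Set V}
    (hF : ∀ U, IsOpen U → MeasurableSet {x | (F x ∩ U).Nonempty})
    (hFc : ∀ x, IsClosed (F x)) (hFb : ∀ x, Bornology.IsBounded (F x)) (hc : 0 ≤ c)
    {O : Set (V →L[ℝ] V)} (hO : IsClosed O) {C : Set (V →L[ℝ] V)} (hC : IsClosed C) :
    MeasurableSet {x | (sandwichingMaps O c (F x) ∩ C).Nonempty} := by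
  have : ProperSpace (V →L[ℝ] V) := FiniteDimensional.proper_real _
  obtain ⟨D, hDB, hDc, hBD⟩ :=
    (TopologicalSpace.IsSeparable.of_separableSpace (O ∩ C)).exists_countable_dense_subset
  have h : {x | (sandwichingMaps O c (F x) ∩ C).Nonempty} =
      ⋂ n : ℕ, ⋃ T ∈ D, {x | IsSandwiched c (F x) (1 / ((n : ℝ) + 1)) T} := by
    ext x
    simp only [Set.mem_ofPred_eq, Set.mem_iInter, Set.mem_iUnion, exists_prop]
    constructor
    · rintro ⟨T, ⟨hTO, hT⟩, hTC⟩ n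
      -- The division by `1 + c` offsets the loss in `IsSandwiched.perturb`.
      obtain ⟨T', hT'D, hT'⟩ := Metric.mem_closure_iff.1 (hBD ⟨hTO, hTC⟩)
        (1 / ((n : ℝ) + 1) / (1 + c)) (by positivity)
      refine ⟨T', hT'D, ?_⟩
      refine ((IsSandwiched.of_subset hT.1 hT.2).perturb hc le_rfl hT'.le).mono (le_of_eq ?_)
      rw [zero_add, mul_div_cancel₀]
      positivity
    · intro h
      choose S hSD hS using h
      obtain ⟨T, φ, hφ, hT⟩ := exists_tendsto_of_isSandwiched hc (hFc x) (hFb x)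
        (fun n => by positivity) tendsto_one_div_add_atTop_nhds_zero_nat hS
      have hm := (hO.inter hC).mem_of_tendsto hφ (.of_forall fun n => hDB (hSD _))
      exact ⟨T, ⟨hm.1, hT⟩, hm.2⟩
  rw [h]
  exact .iInter fun n => .biUnion hDc fun T _ => measurableSet_isSandwiched hF (by positivity)

end Sandwich

/-! ### Measurable selection by lexicographic minimization -/

/-- One step of lexicographic minimization: restrict a measurable compact-valued map to the
minimizers of a continuous function. -/
theorem exists_measurable_argmin {Ω X : Type*} [MeasurableSpace Ω] [TopologicalSpace X]
    {S : Ω → Set X} (hne : ∀ x, (S x).Nonempty) (hcpt : ∀ x, IsCompact (S x))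
    (hmeas : ∀ C, IsClosed C → MeasurableSet {x | (S x ∩ C).Nonempty})
    {f : X → ℝ} (hf : Continuous f) :
    ∃ g : Ω → ℝ, Measurable g ∧ (∀ x, (S x ∩ {a | f a = g x}).Nonempty) ∧
      (∀ x, IsCompact (S x ∩ {a | f a = g x})) ∧
      ∀ C, IsClosed C → MeasurableSet {x | (S x ∩ {a | f a = g x} ∩ C).Nonempty} := by
  choose a haS ha using fun x => (hcpt x).exists_isMinOn (hne x) hf.continuousOn
  have hle : ∀ (C : Set X) (q : ℝ), IsClosed C →
      MeasurableSet {x | (S x ∩ (C ∩ {b | f b ≤ q})).Nonempty} := fun C q hC =>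
    hmeas _ (hC.inter (isClosed_le hf continuous_const))
  have hg : Measurable fun x => f (a x) := by
    refine measurable_of_Iic fun q => ?_
    convert hle Set.univ q isClosed_univ using 1
    ext x
    simp only [Set.mem_preimage, Set.mem_Iic, Set.univ_inter, Set.mem_ofPred_eq]
    exact ⟨fun h => ⟨a x, haS x, h⟩, fun ⟨b, hb, hbq⟩ => (ha x hb).trans hbq⟩
  refine ⟨fun x => f (a x), hg, fun x => ⟨a x, haS x, rfl⟩, fun x =>
    (hcpt x).inter_right (isClosed_eq hf continuous_const), fun C hC => ?_⟩
  -- A minimizer over `S x` lies in `C` iff the minimum over `S x ∩ C` is at most every rational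
  -- above the minimum over `S x`.
  have h : {x | (S x ∩ {b | f b = f (a x)} ∩ C).Nonempty} = {x | (S x ∩ C).Nonempty} ∩
      ⋂ q : ℚ, {x | (q : ℝ) ≤ f (a x)} ∪ {x | (S x ∩ (C ∩ {b | f b ≤ q})).Nonempty} := by
    ext x
    simp only [Set.mem_inter_iff, Set.mem_ofPred_eq, Set.mem_iInter, Set.mem_union]
    constructor
    · rintro ⟨b, ⟨hbS, hb⟩, hbC⟩
      refine ⟨⟨b, hbS, hbC⟩, fun q => (le_or_gt (q : ℝ) (f (a x))).imp id fun hq =>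
        ⟨b, hbS, hbC, ?_⟩⟩
      exact (show f b = f (a x) from hb).trans_le hq.le
    · rintro ⟨hSC, hq⟩
      obtain ⟨b, hb, hbmin⟩ := ((hcpt x).inter_right hC).exists_isMinOn hSC hf.continuousOn
      refine ⟨b, ⟨hb.1, le_antisymm (le_of_forall_rat_lt_imp_le fun q hqb => ?_) (ha x hb.1)⟩, hb.2⟩
      refine (hq q).resolve_right ?_
      rintro ⟨b', hb'S, hb'C, hb'⟩
      exact absurd ((hbmin ⟨hb'S, hb'C⟩).trans hb') (not_le.2 hqb)
  rw [h]
  exact (hmeas C hC).inter (.iInter fun q => (measurableSet_le measurable_const hg).union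
    (hle C q hC))

/-- A measurable map with nonempty compact values has a selection whose composition with each of
finitely many continuous functions is measurable. -/
theorem exists_selection_measurable_comp {Ω X ι : Type*} [MeasurableSpace Ω] [TopologicalSpace X]
    [Finite ι] {f : ι → X → ℝ} (hf : ∀ i, Continuous (f i))
    {S : Ω → Set X} (hne : ∀ x, (S x).Nonempty) (hcpt : ∀ x, IsCompact (S x))
    (hmeas : ∀ C, IsClosed C → MeasurableSet {x | (S x ∩ C).Nonempty}) :
    ∃ s : Ω → X, (∀ x, s x ∈ S x) ∧ ∀ i, Measurable fun x => f i (s x) := by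
  classical
  have := Fintype.ofFinite ι
  have key : ∀ t : Finset ι, ∃ S' : Ω → Set X, (∀ x, S' x ⊆ S x) ∧ (∀ x, (S' x).Nonempty) ∧
      (∀ x, IsCompact (S' x)) ∧
      (∀ C, IsClosed C → MeasurableSet {x | (S' x ∩ C).Nonempty}) ∧
      ∀ i ∈ t, ∃ g : Ω → ℝ, Measurable g ∧ ∀ x, ∀ a ∈ S' x, f i a = g x := by
    intro t
    induction t using Finset.induction_on with
    | empty => exact ⟨S, fun _ => subset_rfl, hne, hcpt, hmeas, by simp⟩
    | insert i t _ ih =>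
      obtain ⟨S', hsub, hne', hcpt', hmeas', hg'⟩ := ih
      obtain ⟨g, hg, h1, h2, h3⟩ := exists_measurable_argmin hne' hcpt' hmeas' (hf i)
      refine ⟨_, fun x => Set.inter_subset_left.trans (hsub x), h1, h2, h3, fun j hj => ?_⟩
      rcases Finset.mem_insert.1 hj with rfl | hj
      · exact ⟨g, hg, fun x a ha => ha.2⟩
      · obtain ⟨g', hgm, hgeq⟩ := hg' j hj
        exact ⟨g', hgm, fun x a ha => hgeq x a ha.1⟩
  obtain ⟨S', hsub, hne', -, -, hg⟩ := key Finset.univ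
  -- Any choice works: each `f i` is constant on `S' x`, with a value measurable in `x`.
  choose s hs using hne'
  refine ⟨s, fun x => hsub x (hs x), fun i => ?_⟩
  obtain ⟨g, hgm, hgeq⟩ := hg i (Finset.mem_univ i)
  simpa only [hgeq _ _ (hs _)] using hgm

/-! ### Orthogonal columns and the final selection -/

/-- The maps sending the standard basis to pairwise orthogonal vectors. -/
def orthogonalColumns (d : ℕ) :
    Set (EuclideanSpace ℝ (Fin d) →L[ℝ] EuclideanSpace ℝ (Fin d)) :=
  {T | ∀ i j : Fin d, i ≠ j →
    inner ℝ (T (EuclideanSpace.single i 1)) (T (EuclideanSpace.single j 1)) = 0}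

theorem isClosed_orthogonalColumns (d : ℕ) : IsClosed (orthogonalColumns d) := by
  simp only [orthogonalColumns, Set.ofPred_forall]
  exact isClosed_iInter fun i => isClosed_iInter fun j => isClosed_iInter fun _ =>
    isClosed_eq (by fun_prop) continuous_const

theorem toEuclideanLin_single_apply {d : ℕ} (A : Matrix (Fin d) (Fin d) ℝ) (i j : Fin d) :
    Matrix.toEuclideanLin A (EuclideanSpace.single j 1) i = A i j := by
  simp [Matrix.toLpLin_apply]

open Matrix in
theorem inner_toEuclideanLin_single {d : ℕ} (A : Matrix (Fin d) (Fin d) ℝ) (i j : Fin d) :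
    inner ℝ (toEuclideanLin A (EuclideanSpace.single i 1))
      (toEuclideanLin A (EuclideanSpace.single j 1)) = A.col i ⬝ᵥ A.col j := by
  rw [EuclideanSpace.inner_eq_star_dotProduct]
  simp [toLpLin_apply, dotProduct_comm]

-- `K` may have empty interior, but contains 0 by symmetry and convexity. Its thickenings therefore
-- contain balls, and John's maps for them sandwich `K` up to `1 / (n + 1)`.
open Metric Filter Topology in
theorem sandwichingMaps_nonempty {d : ℕ} {K : Set (EuclideanSpace ℝ (Fin d))} (hK : K ∈ Kbcs d) :
    (sandwichingMaps (orthogonalColumns d) √d K).Nonempty := by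
  obtain ⟨⟨k, hk⟩, hcl, hbd, hconv, hsymm⟩ := hK
  have h0 : (0 : EuclideanSpace ℝ (Fin d)) ∈ K := by
    have hk' : -k ∈ K := by rw [← hsymm]; simpa using hk
    simpa using hconv.midpoint_mem hk hk'
  have hδ : ∀ n : ℕ, (0 : ℝ) < 1 / (n + 1) := fun n => by positivity
  have hex : ∀ n : ℕ, ∃ T ∈ orthogonalColumns d, IsSandwiched √d K (1 / ((n : ℝ) + 1)) T := by
    intro n
    obtain ⟨A, hA, h1, h2⟩ := exists_john_ellipsoid_of_ball_subset
      (K := cthickening (1 / ((n : ℝ) + 1)) K)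
      (isCompact_of_isClosed_isBounded isClosed_cthickening hbd.cthickening)
      (hconv.cthickening _) (by rw [neg_cthickening, hsymm]) (hδ n)
      (closedBall_subset_cthickening h0 _)
    refine ⟨LinearMap.toContinuousLinearMap (Matrix.toEuclideanLin A), fun i j hij => ?_, h1,
      (self_subset_cthickening K).trans (h2.trans (self_subset_cthickening _))⟩
    exact (inner_toEuclideanLin_single A i j).trans (hA i j hij)
  choose S hSO hS using hex
  obtain ⟨T, φ, hφ, hT⟩ := exists_tendsto_of_isSandwiched (Real.sqrt_nonneg _) hcl hbd
    (fun n => (hδ n).le) tendsto_one_div_add_atTop_nhds_zero_nat hS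
  exact ⟨T, (isClosed_orthogonalColumns d).mem_of_tendsto hφ (.of_forall fun n => hSO _), hT⟩

theorem mainTheorem6 {Ω : Type*} [MeasurableSpace Ω] (d : ℕ) (F : Ω → Kbcs d)
    (hF : SetValuedMeasurable (fun x => (F x : Set (EuclideanSpace ℝ (Fin d))))) :
    ∃ W : Ω → Matrix (Fin d) (Fin d) ℝ,
      (∀ i j : Fin d, Measurable (fun x => W x i j)) ∧
      (∀ x : Ω, ∀ i j : Fin d, i ≠ j → (W x).col i ⬝ᵥ (W x).col j = 0) ∧
      (∀ x : Ω, ellipsoid (W x) ⊆ (F x : Set (EuclideanSpace ℝ (Fin d))) ∧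
        (F x : Set (EuclideanSpace ℝ (Fin d))) ⊆ Real.sqrt d • ellipsoid (W x)) := by
  have hcl : ∀ x, IsClosed (F x : Set (EuclideanSpace ℝ (Fin d))) := fun x => (F x).2.2.1
  have hbd : ∀ x, Bornology.IsBounded (F x : Set (EuclideanSpace ℝ (Fin d))) :=
    fun x => (F x).2.2.2.1
  obtain ⟨T, hTS, hT⟩ := exists_selection_measurable_comp (ι := Fin d × Fin d)
    (f := fun p (T : EuclideanSpace ℝ (Fin d) →L[ℝ] EuclideanSpace ℝ (Fin d)) =>
      T (EuclideanSpace.single p.2 1) p.1)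
    (fun p => by fun_prop) (fun x => sandwichingMaps_nonempty (F x).2)
    (fun x => isCompact_sandwichingMaps (isClosed_orthogonalColumns d) (Real.sqrt_nonneg d)
      (hcl x) (hbd x))
    (fun C hC => measurableSet_sandwichingMaps_inter hF hcl hbd (Real.sqrt_nonneg d)
      (isClosed_orthogonalColumns d) hC)
  have hW : ∀ x, Matrix.toEuclideanLin (Matrix.toEuclideanLin.symm (T x).toLinearMap) =
      (T x).toLinearMap := fun x => LinearEquiv.apply_symm_apply _ _
  refine ⟨fun x => Matrix.toEuclideanLin.symm (T x).toLinearMap, fun i j => ?_,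
    fun x i j hij => ?_, fun x => ?_⟩
  · convert hT (i, j) using 2 with x
    refine (toEuclideanLin_single_apply _ i j).symm.trans ?_
    rw [hW]
    rfl
  · rw [← inner_toEuclideanLin_single, hW]
    exact (hTS x).1 i j hij
  · rw [ellipsoid, hW]
    exact (hTS x).2
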